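/- Let $\mathbb F$ be a field. A (right) Leibniz algebra over $\mathbb F$ is an $\mathbb F$-vector space $\mathfrak g$ with a bilinear bracket satisfying $[[x,y],z]=[[x,z],y]+[x,[y,z]]$. Put $\mathfrak g^{2}=\operatorname{span}\{[x,y]: x,y\in\mathfrak g\}$ and $Z(\mathfrak g)=\{z\in\mathfrak g : [z,x]=[x,z]=0 \text{ for all } x\in\mathfrak g\}$; for a (two-sided) ideal $\mathfrak n$ of $\mathfrak g$ put $Z(\mathfrak g,\mathfrak n)=Z(\mathfrak g)\cap\mathfrak n$. The algebra $\mathfrak g$ is nilpotent if its lower central series $\mathfrak g^{1}=\mathfrak g$, $\mathfrak g^{k+1}=[\mathfrak g^{k},\mathfrak g]$ (the span of the brackets) reaches $0$. Let $d(\mathfrak g)$ denote the minimal number of generators of $\mathfrak g$ as a Leibniz algebra. Let $CL_*(\mathfrak g)$ be the chain complex $CL_k(\mathfrak g)=\mathfrak g^{\otimes k}$ with boundary $$\partial_k(x_1\otimes\cdots\otimes x_k)=\sum_{1\le i<j\le k}(-1)^j\, x_1\otimes\cdots\otimes[x_i,x_j]\otimes\cdots\otimes\widehat{x_j}\otimes\cdots\otimes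 x_k .$$ For an ideal $\mathfrak n$ of $\mathfrak g$ let $M_*$ be the mapping cone of the chain map $\pi_*:CL_*(\mathfrak g)\to CL_*(\mathfrak g/\mathfrak n)$ induced by the projection, that is, $M_k=CL_{k-1}(\mathfrak g)\oplus CL_k(\mathfrak g/\mathfrak n)$ with $\delta_k(a,b)=(-\partial_{k-1}a,\ \bar\partial_k b+\pi_{k-1}(a))$, where $\bar\partial$ is the boundary of $CL_*(\mathfrak g/\mathfrak n)$. The second relative homology of the pair $(\mathfrak g,\mathfrak n)$ is $HL_2(\mathfrak g,\mathfrak n)=H_3(M_*)$. **Theorem.** Let $\mathfrak g$ be a finite-dimensional nilpotent Leibniz algebra over $\mathbb F$ and let $\mathfrak n$ be an ideal of $\mathfrak g$. Then $$\dim HL_2(\mathfrak g,\mathfrak n)\ \le\ \dim HL_2\!\left(\frac{\mathfrak g}{\mathfrak g^2\cap\mathfrak n},\frac{\mathfrak n}{\mathfrak g^2\cap\mathfrak n}\right)+2\,\dim(\mathfrak g^2\cap\mathfrak n)\; d\!\left(\frac{\mathfrak g}{Z(\mathfrak g,\mathfrak n)}\right).$$ -/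

import Mathlib

open scoped TensorProduct

set_option maxSynthPendingDepth 3

/-- A (right) Leibniz algebra over a field: a vector space with a bilinear bracket satisfying
`[[x, y], z] = [[x, z], y] + [x, [y, z]]`. -/
class LeibnizAlgebra (𝕜 L : Type*) [Field 𝕜] [AddCommGroup L] [Module 𝕜 L] where
  /-- The bracket, as a bilinear map. -/
  bracket : L →ₗ[𝕜] L →ₗ[𝕜] L
  /-- The right Leibniz identity. -/
  leibniz : ∀ x y z : L, bracket (bracket x y) z =
    bracket (bracket x z) y + bracket x (bracket y z)

namespace LeibnizAlgebra

noncomputable section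

section Basic

variable (𝕜 : Type*) {L : Type*} [Field 𝕜] [AddCommGroup L] [Module 𝕜 L] [LeibnizAlgebra 𝕜 L]

/-- The bracket `[x, y]`, with the ground field explicit. -/
abbrev br : L →ₗ[𝕜] L →ₗ[𝕜] L := bracket

variable (L)

/-- A (two-sided) ideal of a Leibniz algebra. -/
structure LIdeal extends Submodule 𝕜 L where
  /-- `[x, n] ∈ I` for `x ∈ L` and `n ∈ I`. -/
  br_mem_right : ∀ x n : L, n ∈ carrier → br 𝕜 x n ∈ carrier
  /-- `[n, x] ∈ I` for `x ∈ L` and `n ∈ I`. -/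
  br_mem_left : ∀ x n : L, n ∈ carrier → br 𝕜 n x ∈ carrier

/-- `L² = [L, L]`, the span of all brackets, as an ideal of `L`. -/
def derived : LIdeal 𝕜 L where
  toSubmodule := Submodule.span 𝕜 {z : L | ∃ x y : L, z = br 𝕜 x y}
  br_mem_right x n _ := Submodule.subset_span ⟨x, n, rfl⟩
  br_mem_left x n _ := Submodule.subset_span ⟨n, x, rfl⟩

/-- The (two-sided) centre `Z(L) = {z | [z, x] = 0 = [x, z] for all x}`. -/
def center : LIdeal 𝕜 L where
  carrier := {z : L | ∀ x : L, br 𝕜 z x = 0 ∧ br 𝕜 x z = 0}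
  add_mem' ha hb x := by simp [ha x, hb x]
  zero_mem' x := by simp
  smul_mem' c a ha x := by simp [ha x]
  br_mem_right x n hn y := by simp [(hn x).2]
  br_mem_left x n hn y := by simp [(hn x).1]

/-- The lower central series: `lcs 0 = L` and `lcs (k + 1) = [lcs k, L]`. -/
def lcs : ℕ → Submodule 𝕜 L
  | 0 => ⊤
  | k + 1 => Submodule.span 𝕜 {z : L | ∃ x ∈ lcs k, ∃ y : L, z = br 𝕜 x y}

/-- A Leibniz algebra is nilpotent if its lower central series reaches zero. -/
def IsNilpotent : Prop := ∃ c : ℕ, lcs 𝕜 L c = ⊥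

variable {L} in
/-- A subset `S` generates `L` if the only subalgebra of `L` containing `S` is `L` itself. -/
def Generates (S : Set L) : Prop :=
  ∀ U : Submodule 𝕜 L, (∀ x ∈ U, ∀ y ∈ U, br 𝕜 x y ∈ U) → S ⊆ (U : Set L) → U = ⊤

/-- `d(L)`: the least cardinality of a (finite) set generating `L` as a Leibniz algebra. -/
def minGen : ℕ := sInf {k : ℕ | ∃ S : Finset L, S.card = k ∧ Generates 𝕜 (S : Set L)}

end Basic

section Ideals

variable {𝕜 L : Type*} [Field 𝕜] [AddCommGroup L] [Module 𝕜 L] [LeibnizAlgebra 𝕜 L]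

/-- The intersection of two ideals. -/
def LIdeal.inter (I J : LIdeal 𝕜 L) : LIdeal 𝕜 L where
  toSubmodule := I.toSubmodule ⊓ J.toSubmodule
  br_mem_right x n hn := ⟨I.br_mem_right x n hn.1, J.br_mem_right x n hn.2⟩
  br_mem_left x n hn := ⟨I.br_mem_left x n hn.1, J.br_mem_left x n hn.2⟩

/-- The quotient space `L / I`. -/
abbrev LIdeal.Quot (I : LIdeal 𝕜 L) : Type _ := L ⧸ I.toSubmodule

/-- The projection `L → L / I`. -/
abbrev LIdeal.proj (I : LIdeal 𝕜 L) : L →ₗ[𝕜] I.Quot := I.toSubmodule.mkQ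

/-- The bracket `[x + I, y + I] = [x, y] + I` of the quotient. -/
def LIdeal.quotBracket (I : LIdeal 𝕜 L) : I.Quot →ₗ[𝕜] I.Quot →ₗ[𝕜] I.Quot :=
  I.toSubmodule.liftQ
    (LinearMap.flip (I.toSubmodule.liftQ ((br 𝕜).compr₂ I.proj).flip (by
      intro y hy
      ext x
      exact (Submodule.Quotient.mk_eq_zero _).2 (I.br_mem_right x y hy))))
    (by
      intro x hx
      ext y
      exact (Submodule.Quotient.mk_eq_zero _).2 (I.br_mem_left y x hx))

theorem LIdeal.quotBracket_mk (I : LIdeal 𝕜 L) (x y : L) :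
    I.quotBracket (I.proj x) (I.proj y) = I.proj (br 𝕜 x y) := rfl

/-- The quotient Leibniz algebra `L / I`. -/
instance LIdeal.instQuot (I : LIdeal 𝕜 L) : LeibnizAlgebra 𝕜 I.Quot where
  bracket := I.quotBracket
  leibniz := by
    intro x y z
    obtain ⟨x, rfl⟩ := I.toSubmodule.mkQ_surjective x
    obtain ⟨y, rfl⟩ := I.toSubmodule.mkQ_surjective y
    obtain ⟨z, rfl⟩ := I.toSubmodule.mkQ_surjective z
    simp only [LIdeal.quotBracket_mk, ← map_add]
    exact congrArg _ (leibniz x y z)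

theorem LIdeal.br_proj (I : LIdeal 𝕜 L) (x y : L) :
    br 𝕜 (I.proj x) (I.proj y) = I.proj (br 𝕜 x y) := rfl

/-- The image of the ideal `J` of `L` in `L / I`; this is `J / I` when `I ⊆ J`. -/
def LIdeal.image (I J : LIdeal 𝕜 L) : LIdeal 𝕜 I.Quot where
  toSubmodule := J.toSubmodule.map I.proj
  br_mem_right x n hn := by
    obtain ⟨x, rfl⟩ := I.toSubmodule.mkQ_surjective x
    obtain ⟨n, hn, rfl⟩ := hn
    exact ⟨br 𝕜 x n, J.br_mem_right x n hn, (I.br_proj x n).symm⟩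
  br_mem_left x n hn := by
    obtain ⟨x, rfl⟩ := I.toSubmodule.mkQ_surjective x
    obtain ⟨n, hn, rfl⟩ := hn
    exact ⟨br 𝕜 n x, J.br_mem_left x n hn, (I.br_proj n x).symm⟩

end Ideals

section Chains

variable (𝕜 L : Type*) [Field 𝕜] [AddCommGroup L] [Module 𝕜 L] [LeibnizAlgebra 𝕜 L]

/-! The Leibniz chain complex `CL_n(L) = L ⊗ ⋯ ⊗ L` (`n` factors), with boundary
`∂(x₁ ⊗ ⋯ ⊗ xₙ) = ∑_{i < j} (-1)^j x₁ ⊗ ⋯ ⊗ [xᵢ, xⱼ] ⊗ ⋯ ⊗ x̂ⱼ ⊗ ⋯ ⊗ xₙ`, in degrees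
one to four. The summands with `j < n` form `∂(x₁ ⊗ ⋯ ⊗ xₙ₋₁) ⊗ xₙ`; those with `j = n` are
`(-1)^n` times the action of `xₙ` on `x₁ ⊗ ⋯ ⊗ xₙ₋₁`. The formulas on pure tensors are
proved below. -/

/-- Right action of `L` on `L ⊗ L`: `(x ⊗ y) · z = [x, z] ⊗ y + x ⊗ [y, z]`. -/
def act2 : L →ₗ[𝕜] (L ⊗[𝕜] L →ₗ[𝕜] L ⊗[𝕜] L) :=
  LinearMap.rTensorHom L ∘ₗ (br 𝕜).flip + LinearMap.lTensorHom L ∘ₗ (br 𝕜).flip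

/-- Right action of `L` on `L ⊗ L ⊗ L`. -/
def act3 : L →ₗ[𝕜] (L ⊗[𝕜] L ⊗[𝕜] L →ₗ[𝕜] L ⊗[𝕜] L ⊗[𝕜] L) :=
  LinearMap.rTensorHom L ∘ₗ act2 𝕜 L + LinearMap.lTensorHom (L ⊗[𝕜] L) ∘ₗ (br 𝕜).flip

/-- `∂₂ : CL₂ → CL₁`. -/
def d2 : L ⊗[𝕜] L →ₗ[𝕜] L := TensorProduct.lift (br 𝕜)

/-- `∂₃ : CL₃ → CL₂`. -/
def d3 : L ⊗[𝕜] L ⊗[𝕜] L →ₗ[𝕜] L ⊗[𝕜] L :=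
  (d2 𝕜 L).rTensor L - TensorProduct.lift (act2 𝕜 L).flip

/-- `∂₄ : CL₄ → CL₃`. -/
def d4 : L ⊗[𝕜] L ⊗[𝕜] L ⊗[𝕜] L →ₗ[𝕜] L ⊗[𝕜] L ⊗[𝕜] L :=
  (d3 𝕜 L).rTensor L + TensorProduct.lift (act3 𝕜 L).flip

variable {L}

theorem d2_tmul (x y : L) : d2 𝕜 L (x ⊗ₜ y) = br 𝕜 x y := rfl

theorem d3_tmul (x y z : L) :
    d3 𝕜 L (x ⊗ₜ y ⊗ₜ z) =
      br 𝕜 x y ⊗ₜ z - br 𝕜 x z ⊗ₜ y - x ⊗ₜ br 𝕜 y z := by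
  simp [d3, d2, act2, sub_sub]

theorem d4_tmul (x y z w : L) :
    d4 𝕜 L (x ⊗ₜ y ⊗ₜ z ⊗ₜ w) =
      br 𝕜 x y ⊗ₜ z ⊗ₜ w - br 𝕜 x z ⊗ₜ y ⊗ₜ w - x ⊗ₜ br 𝕜 y z ⊗ₜ w
        + br 𝕜 x w ⊗ₜ y ⊗ₜ z + x ⊗ₜ br 𝕜 y w ⊗ₜ z + x ⊗ₜ y ⊗ₜ br 𝕜 z w := by
  simp [d4, d3_tmul, act3, act2, TensorProduct.sub_tmul]
  abel

theorem d2_d3 (t : L ⊗[𝕜] L ⊗[𝕜] L) : d2 𝕜 L (d3 𝕜 L t) = 0 := by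
  suffices h : d2 𝕜 L ∘ₗ d3 𝕜 L = 0 from LinearMap.congr_fun h t
  ext x y z
  simp [d3_tmul, d2_tmul, leibniz x y z]

theorem d3_d4 (t : L ⊗[𝕜] L ⊗[𝕜] L ⊗[𝕜] L) : d3 𝕜 L (d4 𝕜 L t) = 0 := by
  suffices h : d3 𝕜 L ∘ₗ d4 𝕜 L = 0 from LinearMap.congr_fun h t
  ext x y z w
  have h1 := leibniz (𝕜 := 𝕜) x y z
  have h2 := leibniz (𝕜 := 𝕜) x y w
  have h3 := leibniz (𝕜 := 𝕜) x z w
  have h4 := leibniz (𝕜 := 𝕜) y z w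
  simp [d4_tmul, d3_tmul, h1, h2, h3, h4, TensorProduct.add_tmul, TensorProduct.tmul_add]
  abel

end Chains

section Homology

variable {𝕜 A B C : Type*} [Field 𝕜] [AddCommGroup A] [Module 𝕜 A] [AddCommGroup B] [Module 𝕜 B]
  [AddCommGroup C] [Module 𝕜 C]

/-- The homology `ker g / im f` at `B` of a complex `A → B → C` of vector spaces. -/
abbrev HomologyAt (f : A →ₗ[𝕜] B) (g : B →ₗ[𝕜] C) : Type _ :=
  LinearMap.ker g ⧸ (LinearMap.range f).comap (LinearMap.ker g).subtype

end Homology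

section Relative

variable {𝕜 L Q : Type*} [Field 𝕜] [AddCommGroup L] [Module 𝕜 L] [LeibnizAlgebra 𝕜 L]
  [AddCommGroup Q] [Module 𝕜 Q] [LeibnizAlgebra 𝕜 Q]

/-- `π₂ = π ⊗ π : CL₂(L) → CL₂(Q)`. -/
def map2 (π : L →ₗ[𝕜] Q) : L ⊗[𝕜] L →ₗ[𝕜] Q ⊗[𝕜] Q := TensorProduct.map π π

/-- `π₃ = π ⊗ π ⊗ π : CL₃(L) → CL₃(Q)`. -/
def map3 (π : L →ₗ[𝕜] Q) : L ⊗[𝕜] L ⊗[𝕜] L →ₗ[𝕜] Q ⊗[𝕜] Q ⊗[𝕜] Q :=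
  TensorProduct.map (map2 π) π

/-! The mapping cone of a homomorphism `π : L → Q` on chains is
`M_n = CL_{n-1}(L) ⊕ CL_n(Q)`, with boundary `δ_n(a, b) = (-∂ a, ∂ b + π a)`. -/

/-- `δ₃ : M₃ → M₂`, from `CL₂(L) ⊕ CL₃(Q)` to `CL₁(L) ⊕ CL₂(Q)`. -/
def coneD3 (π : L →ₗ[𝕜] Q) :
    ((L ⊗[𝕜] L) × (Q ⊗[𝕜] Q ⊗[𝕜] Q)) →ₗ[𝕜] (L × (Q ⊗[𝕜] Q)) :=
  LinearMap.prod (-(d2 𝕜 L ∘ₗ LinearMap.fst 𝕜 _ _))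
    (d3 𝕜 Q ∘ₗ LinearMap.snd 𝕜 _ _ + map2 π ∘ₗ LinearMap.fst 𝕜 _ _)

/-- `δ₄ : M₄ → M₃`, from `CL₃(L) ⊕ CL₄(Q)` to `CL₂(L) ⊕ CL₃(Q)`. -/
def coneD4 (π : L →ₗ[𝕜] Q) :
    ((L ⊗[𝕜] L ⊗[𝕜] L) × (Q ⊗[𝕜] Q ⊗[𝕜] Q ⊗[𝕜] Q)) →ₗ[𝕜]
      ((L ⊗[𝕜] L) × (Q ⊗[𝕜] Q ⊗[𝕜] Q)) :=
  LinearMap.prod (-(d3 𝕜 L ∘ₗ LinearMap.fst 𝕜 _ _))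
    (d4 𝕜 Q ∘ₗ LinearMap.snd 𝕜 _ _ + map3 π ∘ₗ LinearMap.fst 𝕜 _ _)

theorem coneD3_apply (π : L →ₗ[𝕜] Q) (a : L ⊗[𝕜] L) (b : Q ⊗[𝕜] Q ⊗[𝕜] Q) :
    coneD3 π (a, b) = (-d2 𝕜 L a, d3 𝕜 Q b + map2 π a) := rfl

theorem coneD4_apply (π : L →ₗ[𝕜] Q) (a : L ⊗[𝕜] L ⊗[𝕜] L)
    (b : Q ⊗[𝕜] Q ⊗[𝕜] Q ⊗[𝕜] Q) :
    coneD4 π (a, b) = (-d3 𝕜 L a, d4 𝕜 Q b + map3 π a) := rfl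

theorem d3_map3 (π : L →ₗ[𝕜] Q) (hπ : ∀ x y : L, π (br 𝕜 x y) = br 𝕜 (π x) (π y))
    (t : L ⊗[𝕜] L ⊗[𝕜] L) : d3 𝕜 Q (map3 π t) = map2 π (d3 𝕜 L t) := by
  suffices h : d3 𝕜 Q ∘ₗ map3 π = map2 π ∘ₗ d3 𝕜 L from LinearMap.congr_fun h t
  ext x y z
  simp [map3, map2, d3_tmul, hπ]

/-- `δ₃ ∘ δ₄ = 0`. -/
theorem coneD3_coneD4 (π : L →ₗ[𝕜] Q) (hπ : ∀ x y : L, π (br 𝕜 x y) = br 𝕜 (π x) (π y)) :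
    coneD3 π ∘ₗ coneD4 π = 0 := by
  refine LinearMap.ext fun p => ?_
  obtain ⟨a, b⟩ := p
  simp [coneD3_apply, coneD4_apply, d2_d3, d3_d4, d3_map3 π hπ]

/-- `H₃(M) = ker δ₃ / im δ₄` for the mapping cone `M` of `π`. -/
abbrev ConeH3 (π : L →ₗ[𝕜] Q) : Type _ := HomologyAt (coneD4 π) (coneD3 π)

/-- The second relative homology `HL₂(L, I)`: the third homology of the mapping cone of the
chain map `CL(L) → CL(L / I)` induced by the projection. -/
abbrev HL2 (I : LIdeal 𝕜 L) : Type _ := ConeH3 I.proj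

end Relative

end

end LeibnizAlgebra

namespace LeibnizAlgebra

noncomputable section

/-! Put `I = g² ∩ n`. Projection modulo `I` maps the cone of `(g, n)` to that of `(g/I, n/I)`, so it
suffices to bound the kernel on homology by `2 dim I · d(g/Z(g, n))`. Since `g/n` and `(g/I)/(n/I)`
agree, a class in this kernel is represented by some `(a, 0)` with `a` in `g ⊗ I + I ⊗ g`
(`LIdeal.exists_sub_coneD4_eq`). Fewer tensors suffice modulo boundaries (`tmul_mem_of_generates`):
the `x` for which `x ⊗ I` and `I ⊗ x` are already accounted for form a subalgebra, by the formula
for `∂₃`. It contains `Z(g, n)` because `I` lies in `g²`. Hence `x` may be restricted to lifts of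
generators of `g/Z(g, n)`, and `i` to a basis of `I`; the two orders of the factors give the 2. -/

/-- Homology dimensions along a linear map that sends cycles to cycles, when the cycles that
become boundaries are, modulo boundaries, contained in `W`. -/
theorem finrank_quotient_le_add {𝕜 M M' : Type*} [Field 𝕜] [AddCommGroup M] [Module 𝕜 M]
    [AddCommGroup M'] [Module 𝕜 M'] [FiniteDimensional 𝕜 M] [FiniteDimensional 𝕜 M']
    (F : M →ₗ[𝕜] M') (C B W : Submodule 𝕜 M) (C' B' : Submodule 𝕜 M')
    (hC : C ≤ C'.comap F) (hB : B ≤ B'.comap F)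
    (hW : ∀ m : M, F m ∈ B' → m ∈ W ⊔ B) :
    Module.finrank 𝕜 (C ⧸ B.comap C.subtype) ≤
      Module.finrank 𝕜 (C' ⧸ B'.comap C'.subtype) + Module.finrank 𝕜 W := by
  let ψ : (C ⧸ B.comap C.subtype) →ₗ[𝕜] (C' ⧸ B'.comap C'.subtype) :=
    Submodule.mapQ _ _ (F.restrict hC) (fun x hx => hB hx)
  -- `W` need not consist of cycles, so the kernel of `ψ` is compared with it inside `M ⧸ B`.
  let ι : (C ⧸ B.comap C.subtype) →ₗ[𝕜] (M ⧸ B) := Submodule.mapQ _ _ C.subtype le_rfl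
  have hι : Function.Injective ι := by
    rw [← LinearMap.ker_eq_bot, LinearMap.ker_eq_bot']
    intro q hq
    obtain ⟨x, rfl⟩ := Submodule.mkQ_surjective _ q
    have hx : (x : M) ∈ B := (Submodule.Quotient.mk_eq_zero B (x := (x : M))).1 hq
    exact (Submodule.Quotient.mk_eq_zero _).2 hx
  have hker : (LinearMap.ker ψ).map ι ≤ W.map B.mkQ := by
    rintro _ ⟨q, hq, rfl⟩
    obtain ⟨x, rfl⟩ := Submodule.mkQ_surjective _ q
    have hx : F x ∈ B' := (Submodule.Quotient.mk_eq_zero (B'.comap C'.subtype)).1 (LinearMap.mem_ker.1 hq)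
    obtain ⟨w, hw, b, hb, hwb⟩ := Submodule.mem_sup.1 (hW x hx)
    refine ⟨w, hw, ?_⟩
    refine (Submodule.Quotient.eq B).2 ?_
    change w - (x : M) ∈ B
    rw [← hwb, sub_add_cancel_left]
    exact B.neg_mem hb
  have h1 := LinearMap.finrank_range_add_finrank_ker ψ
  have h2 := Submodule.finrank_le (LinearMap.range ψ)
  have h3 : Module.finrank 𝕜 (LinearMap.ker ψ) ≤ Module.finrank 𝕜 W :=
    calc Module.finrank 𝕜 (LinearMap.ker ψ)
        = Module.finrank 𝕜 ((LinearMap.ker ψ).map ι) :=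
          (LinearEquiv.finrank_eq (Submodule.equivMapOfInjective ι hι _))
      _ ≤ Module.finrank 𝕜 (W.map B.mkQ) := Submodule.finrank_mono hker
      _ ≤ Module.finrank 𝕜 W := Submodule.finrank_map_le _ _
  omega

/-! ### Tensor powers of linear maps -/

section TensorPowers

variable {𝕜 L Q : Type*} [Field 𝕜] [AddCommGroup L] [Module 𝕜 L] [AddCommGroup Q] [Module 𝕜 Q]

/-- `π ⊗ π ⊗ π ⊗ π : CL₄(L) → CL₄(Q)`. -/
def map4 (π : L →ₗ[𝕜] Q) : L ⊗[𝕜] L ⊗[𝕜] L ⊗[𝕜] L →ₗ[𝕜] Q ⊗[𝕜] Q ⊗[𝕜] Q ⊗[𝕜] Q :=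
  TensorProduct.map (map3 π) π

theorem map2_surjective {π : L →ₗ[𝕜] Q} (h : Function.Surjective π) :
    Function.Surjective (map2 π) := TensorProduct.map_surjective h h

theorem map3_surjective {π : L →ₗ[𝕜] Q} (h : Function.Surjective π) :
    Function.Surjective (map3 π) := TensorProduct.map_surjective (map2_surjective h) h

theorem map4_surjective {π : L →ₗ[𝕜] Q} (h : Function.Surjective π) :
    Function.Surjective (map4 π) := TensorProduct.map_surjective (map3_surjective h) h

theorem map3_injective {π : L →ₗ[𝕜] Q} (h : Function.Injective π) :
    Function.Injective (map3 π) :=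
  TensorProduct.map_injective_of_flat_flat _ _
    (TensorProduct.map_injective_of_flat_flat _ _ h h) h

/-- The span of the chains `x ⊗ i` and `i ⊗ x`, for `i` in a basis of `I` and `x` in a finite
family, in dimension-counting form. -/
theorem exists_submodule_tmul_mem (I : Submodule 𝕜 L) [FiniteDimensional 𝕜 I]
    {σ : Type*} [Fintype σ] (v : σ → L) :
    ∃ W : Submodule 𝕜 ((L ⊗[𝕜] L) × Q),
      Module.finrank 𝕜 W ≤ 2 * Module.finrank 𝕜 I * Fintype.card σ ∧
      ∀ s, ∀ i ∈ I, (v s ⊗ₜ[𝕜] i, (0 : Q)) ∈ W ∧ (i ⊗ₜ[𝕜] v s, (0 : Q)) ∈ W := by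
  let b := Module.finBasis 𝕜 I
  let f : (σ × Fin (Module.finrank 𝕜 I)) ⊕ (σ × Fin (Module.finrank 𝕜 I)) → (L ⊗[𝕜] L) × Q :=
    Sum.elim (fun p => (v p.1 ⊗ₜ (b p.2 : L), 0)) (fun p => ((b p.2 : L) ⊗ₜ v p.1, 0))
  refine ⟨Submodule.span 𝕜 (Set.range f), ?_, ?_⟩
  · refine (finrank_range_le_card f).trans (le_of_eq ?_)
    simp only [Fintype.card_sum, Fintype.card_prod, Fintype.card_fin]
    ring
  · intro s i hi
    let W := Submodule.span 𝕜 (Set.range f)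
    let l : I →ₗ[𝕜] (L ⊗[𝕜] L) × Q :=
      LinearMap.inl 𝕜 _ _ ∘ₗ TensorProduct.mk 𝕜 L L (v s) ∘ₗ I.subtype
    let r : I →ₗ[𝕜] (L ⊗[𝕜] L) × Q :=
      LinearMap.inl 𝕜 _ _ ∘ₗ (TensorProduct.mk 𝕜 L L).flip (v s) ∘ₗ I.subtype
    have hl : (⊤ : Submodule 𝕜 I) ≤ W.comap l := by
      rw [← b.span_eq, Submodule.span_le]
      rintro _ ⟨k, rfl⟩
      exact Submodule.subset_span ⟨.inl (s, k), rfl⟩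
    have hr : (⊤ : Submodule 𝕜 I) ≤ W.comap r := by
      rw [← b.span_eq, Submodule.span_le]
      rintro _ ⟨k, rfl⟩
      exact Submodule.subset_span ⟨.inr (s, k), rfl⟩
    exact ⟨hl (Submodule.mem_top (x := ⟨i, hi⟩)), hr (Submodule.mem_top (x := ⟨i, hi⟩))⟩

end TensorPowers

/-! ### Chain maps, cone boundaries and generators -/

section Functoriality

variable {𝕜 L Q : Type*} [Field 𝕜] [AddCommGroup L] [Module 𝕜 L] [LeibnizAlgebra 𝕜 L]
  [AddCommGroup Q] [Module 𝕜 Q] [LeibnizAlgebra 𝕜 Q]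

theorem d2_map2 (π : L →ₗ[𝕜] Q) (hπ : ∀ x y : L, π (br 𝕜 x y) = br 𝕜 (π x) (π y))
    (t : L ⊗[𝕜] L) : d2 𝕜 Q (map2 π t) = π (d2 𝕜 L t) := by
  suffices h : d2 𝕜 Q ∘ₗ map2 π = π ∘ₗ d2 𝕜 L from LinearMap.congr_fun h t
  ext x y
  simp [map2, d2_tmul, hπ]

theorem d4_map4 (π : L →ₗ[𝕜] Q) (hπ : ∀ x y : L, π (br 𝕜 x y) = br 𝕜 (π x) (π y))
    (t : L ⊗[𝕜] L ⊗[𝕜] L ⊗[𝕜] L) : d4 𝕜 Q (map4 π t) = map3 π (d4 𝕜 L t) := by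
  suffices h : d4 𝕜 Q ∘ₗ map4 π = map3 π ∘ₗ d4 𝕜 L from LinearMap.congr_fun h t
  ext x y z w
  simp [map4, map3, map2, d4_tmul, hπ]

/-- For a surjective homomorphism `π`, every 3-boundary of its mapping cone is the boundary of a
chain with vanishing second component. -/
theorem exists_coneD4_eq {π : L →ₗ[𝕜] Q} (hπ : ∀ x y : L, π (br 𝕜 x y) = br 𝕜 (π x) (π y))
    (hs : Function.Surjective π) {m : (L ⊗[𝕜] L) × (Q ⊗[𝕜] Q ⊗[𝕜] Q)}
    (hm : m ∈ LinearMap.range (coneD4 π)) : ∃ c, coneD4 π (c, 0) = m := by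
  obtain ⟨⟨c, e⟩, rfl⟩ := hm
  obtain ⟨f, rfl⟩ := map4_surjective hs e
  -- Subtracting the cone boundary `(-∂f, π f)` of `(f, 0)` from `(c, π f)` clears the second
  -- component.
  refine ⟨c + d4 𝕜 L f, ?_⟩
  simp [coneD4_apply, d3_d4, d4_map4 π hπ, add_comm]

/-- If `π t = 0` then `(∂t, 0)` is a boundary of the mapping cone of `π`. -/
theorem d3_mem_range_coneD4 (π : L →ₗ[𝕜] Q) {t : L ⊗[𝕜] L ⊗[𝕜] L} (ht : map3 π t = 0) :
    ((d3 𝕜 L t, 0) : (L ⊗[𝕜] L) × (Q ⊗[𝕜] Q ⊗[𝕜] Q)) ∈ LinearMap.range (coneD4 π) :=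
  ⟨(-t, 0), by simp [coneD4_apply, ht]⟩

/-- The image of `U` is a subalgebra containing `S`, hence everything, and a subspace containing
`ker p` is the full preimage of its image. This transfers generation of `g/Z(g, n)` to `g`. -/
theorem Generates.eq_top_of_map_le {L' : Type*} [AddCommGroup L'] [Module 𝕜 L']
    [LeibnizAlgebra 𝕜 L'] {p : L →ₗ[𝕜] L'}
    (hp : ∀ x y : L, p (br 𝕜 x y) = br 𝕜 (p x) (p y)) {S : Set L'} (hS : Generates 𝕜 S)
    {U : Submodule 𝕜 L} (hU : ∀ x ∈ U, ∀ y ∈ U, br 𝕜 x y ∈ U) (hker : LinearMap.ker p ≤ U)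
    (hSU : S ⊆ (U.map p : Set L')) : U = ⊤ := by
  have h : U.map p = ⊤ := by
    refine hS _ ?_ hSU
    rintro _ ⟨x, hx, rfl⟩ _ ⟨y, hy, rfl⟩
    exact ⟨_, hU x hx y hy, hp x y⟩
  refine eq_top_iff.2 fun x _ => ?_
  obtain ⟨u, hu, hux⟩ : p x ∈ U.map p := h ▸ Submodule.mem_top
  have : x - u ∈ U := hker (by simp [hux])
  simpa using U.add_mem this hu

/-- The value `d(L)` is attained when `L` is finite-dimensional. -/
theorem exists_generates_card_eq_minGen [FiniteDimensional 𝕜 L] :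
    ∃ S : Finset L, S.card = minGen 𝕜 L ∧ Generates 𝕜 (S : Set L) := by
  refine Nat.sInf_mem (s := {k | ∃ S : Finset L, S.card = k ∧ Generates 𝕜 (S : Set L)}) ?_
  -- A finite spanning set generates, so the infimum is not the default `sInf ∅ = 0`.
  obtain ⟨S, hS⟩ := Module.Finite.fg_top (R := 𝕜) (M := L)
  exact ⟨_, S, rfl, fun U _ hSU => eq_top_iff.2 (hS ▸ Submodule.span_le.2 hSU)⟩

end Functoriality

/-! ### Reduction to generators modulo `Z(L, n)` -/

section Relative

variable {𝕜 L : Type*} [Field 𝕜] [AddCommGroup L] [Module 𝕜 L] [LeibnizAlgebra 𝕜 L]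

theorem LIdeal.proj_eq_zero {n : LIdeal 𝕜 L} {x : L} (hx : x ∈ n.toSubmodule) : n.proj x = 0 :=
  (Submodule.Quotient.mk_eq_zero _).2 hx

/-- Let `I = L² ∩ n`. A subspace of 2-chains that contains the boundaries of the relative 3-chains
of `(L, n)`, and contains `x ⊗ I` and `I ⊗ x` for `x` in a set of generators of `L` modulo
`Z(L, n)`, contains `L ⊗ I` and `I ⊗ L`. -/
theorem tmul_mem_of_generates {n : LIdeal 𝕜 L} {E : Submodule 𝕜 (L ⊗[𝕜] L)}
    (hE : ∀ t, map3 n.proj t = 0 → d3 𝕜 L t ∈ E)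
    {S : Set ((center 𝕜 L).inter n).Quot} (hS : Generates 𝕜 S)
    (hSE : ∀ s ∈ S, ∃ x, ((center 𝕜 L).inter n).proj x = s ∧
      ∀ i ∈ ((derived 𝕜 L).inter n).toSubmodule, x ⊗ₜ[𝕜] i ∈ E ∧ i ⊗ₜ[𝕜] x ∈ E)
    (x i : L) (hi : i ∈ ((derived 𝕜 L).inter n).toSubmodule) :
    x ⊗ₜ[𝕜] i ∈ E ∧ i ⊗ₜ[𝕜] x ∈ E := by
  let U : Submodule 𝕜 L :=
    { carrier := {x | ∀ i ∈ ((derived 𝕜 L).inter n).toSubmodule,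
        x ⊗ₜ[𝕜] i ∈ E ∧ i ⊗ₜ[𝕜] x ∈ E}
      add_mem' := fun {x y} hx hy i hi => by
        rw [TensorProduct.add_tmul, TensorProduct.tmul_add]
        exact ⟨E.add_mem (hx i hi).1 (hy i hi).1, E.add_mem (hx i hi).2 (hy i hi).2⟩
      zero_mem' := fun i hi => by simp
      smul_mem' := fun c x hx i hi => by
        rw [← TensorProduct.smul_tmul', TensorProduct.tmul_smul]
        exact ⟨E.smul_mem c (hx i hi).1, E.smul_mem c (hx i hi).2⟩ }
  -- A factor in `n` kills `x ⊗ y ⊗ z` in `CL₃(L/n)`, so its boundary lies in `E`.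
  have h0 : ∀ x y z : L, (n.proj x = 0 ∨ n.proj y = 0 ∨ n.proj z = 0) →
      br 𝕜 x y ⊗ₜ[𝕜] z - br 𝕜 x z ⊗ₜ y - x ⊗ₜ br 𝕜 y z ∈ E := by
    intro x y z h
    rw [← d3_tmul]
    refine hE _ ?_
    simp only [map3, map2, TensorProduct.map_tmul]
    rcases h with h | h | h <;> simp only [h, TensorProduct.zero_tmul, TensorProduct.tmul_zero]
  suffices hU : U = ⊤ from (hU ▸ Submodule.mem_top : x ∈ U) i hi
  refine hS.eq_top_of_map_le (fun x y => (LIdeal.br_proj _ x y).symm) ?_ ?_ ?_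
  -- Closure under brackets: in `∂(x ⊗ y ⊗ i)` and `∂(i ⊗ x ⊗ y)` every term without `[x, y]` pairs
  -- `x` or `y` with an element of the ideal `I`.
  · intro x hx y hy i hi
    constructor
    · have h := h0 x y i (.inr (.inr (n.proj_eq_zero hi.2)))
      have h1 := (hy _ (((derived 𝕜 L).inter n).br_mem_right x i hi)).2
      have h2 := (hx _ (((derived 𝕜 L).inter n).br_mem_right y i hi)).1
      simpa using E.add_mem (E.add_mem h h2) h1
    · have h := h0 i x y (.inl (n.proj_eq_zero hi.2))
      have h1 := (hy _ (((derived 𝕜 L).inter n).br_mem_left x i hi)).2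
      have h2 := (hx _ (((derived 𝕜 L).inter n).br_mem_left y i hi)).2
      have := E.sub_mem (E.sub_mem h1 h2) h
      simpa using this
  · intro z hz i hi
    rw [Submodule.ker_mkQ] at hz
    have hc : ∀ x, br 𝕜 z x = 0 ∧ br 𝕜 x z = 0 := hz.1
    have hzn := n.proj_eq_zero hz.2
    -- For central `z` in `n`, `∂(z ⊗ x ⊗ y) = -z ⊗ [x, y]` and `∂(x ⊗ y ⊗ z) = [x, y] ⊗ z`. Only `i
    -- ∈ L²` is retained, as the brackets spanning `L²` need not lie in `n`.
    have hi' : i ∈ Submodule.span 𝕜 {w : L | ∃ x y : L, w = br 𝕜 x y} := hi.1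
    clear hi
    induction hi' using Submodule.span_induction with
    | mem w hw =>
      obtain ⟨x, y, rfl⟩ := hw
      have h1 := h0 z x y (.inl hzn)
      have h2 := h0 x y z (.inr (.inr hzn))
      simp only [(hc _).1, TensorProduct.zero_tmul, sub_self, zero_sub] at h1
      simp only [(hc _).2, TensorProduct.zero_tmul, TensorProduct.tmul_zero, sub_zero] at h2
      exact ⟨neg_mem_iff.1 h1, h2⟩
    | zero => simp
    | add a b _ _ ha hb =>
      rw [TensorProduct.add_tmul, TensorProduct.tmul_add]
      exact ⟨E.add_mem ha.1 hb.1, E.add_mem ha.2 hb.2⟩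
    | smul c a _ ha =>
      rw [← TensorProduct.smul_tmul', TensorProduct.tmul_smul]
      exact ⟨E.smul_mem c ha.1, E.smul_mem c ha.2⟩
  · intro s hs
    obtain ⟨x, rfl, hx⟩ := hSE s hs
    exact ⟨x, hx, rfl⟩

/-- A subspace of `L ⊗ L` containing `L ⊗ I` and `I ⊗ L` contains the kernel of
`L ⊗ L → L/I ⊗ L/I`. -/
theorem ker_map2_proj_le {I : LIdeal 𝕜 L} {E : Submodule 𝕜 (L ⊗[𝕜] L)}
    (h : ∀ x, ∀ i ∈ I.toSubmodule, x ⊗ₜ[𝕜] i ∈ E ∧ i ⊗ₜ[𝕜] x ∈ E) :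
    LinearMap.ker (map2 I.proj) ≤ E := by
  have hex : Function.Exact I.toSubmodule.subtype I.proj :=
    LinearMap.exact_subtype_mkQ I.toSubmodule
  rw [map2, TensorProduct.map_ker hex I.toSubmodule.mkQ_surjective hex
    I.toSubmodule.mkQ_surjective]
  refine sup_le ?_ ?_
  · rintro _ ⟨t, rfl⟩
    induction t with
    | zero => simp
    | tmul x i => exact (h x i i.2).1
    | add a b ha hb => rw [map_add]; exact E.add_mem ha hb
  · rintro _ ⟨t, rfl⟩
    induction t with
    | zero => simp
    | tmul i x => exact (h x i i.2).2
    | add a b ha hb => rw [map_add]; exact E.add_mem ha hb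

/-! ### Comparison of the cones of `(L, J)` and `(L/I, J/I)` -/

/-- The map `L / J → (L / I) / (J / I)` induced by the projection. -/
def LIdeal.quotMap (I J : LIdeal 𝕜 L) : J.Quot →ₗ[𝕜] (I.image J).Quot :=
  Submodule.mapQ _ _ I.proj fun x hx => ⟨x, hx, rfl⟩

theorem LIdeal.quotMap_proj (I J : LIdeal 𝕜 L) (x : L) :
    I.quotMap J (J.proj x) = (I.image J).proj (I.proj x) := rfl

theorem LIdeal.quotMap_br (I J : LIdeal 𝕜 L) (a b : J.Quot) :
    I.quotMap J (br 𝕜 a b) = br 𝕜 (I.quotMap J a) (I.quotMap J b) := by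
  obtain ⟨x, rfl⟩ := J.toSubmodule.mkQ_surjective a
  obtain ⟨y, rfl⟩ := J.toSubmodule.mkQ_surjective b
  rfl

theorem LIdeal.quotMap_injective {I J : LIdeal 𝕜 L} (h : I.toSubmodule ≤ J.toSubmodule) :
    Function.Injective (I.quotMap J) := by
  rw [← LinearMap.ker_eq_bot, LinearMap.ker_eq_bot']
  intro a ha
  obtain ⟨x, rfl⟩ := J.toSubmodule.mkQ_surjective a
  obtain ⟨y, hy, hyx⟩ := (Submodule.Quotient.mk_eq_zero _).1 ha
  refine LIdeal.proj_eq_zero ?_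
  have hxy : y - x ∈ I.toSubmodule := (Submodule.Quotient.eq _).1 hyx
  simpa using J.toSubmodule.sub_mem hy (h hxy)

/-- The map from the cone of `L → L / J` to the cone of `L / I → (L / I) / (J / I)`, in
degree three. -/
def LIdeal.coneMap (I J : LIdeal 𝕜 L) :
    ((L ⊗[𝕜] L) × (J.Quot ⊗[𝕜] J.Quot ⊗[𝕜] J.Quot)) →ₗ[𝕜]
      ((I.Quot ⊗[𝕜] I.Quot) ×
        ((I.image J).Quot ⊗[𝕜] (I.image J).Quot ⊗[𝕜] (I.image J).Quot)) :=
  LinearMap.prodMap (map2 I.proj) (map3 (I.quotMap J))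

theorem LIdeal.map2_quotMap (I J : LIdeal 𝕜 L) (t : L ⊗[𝕜] L) :
    map2 (I.quotMap J) (map2 J.proj t) = map2 (I.image J).proj (map2 I.proj t) := by
  suffices h : map2 (I.quotMap J) ∘ₗ map2 J.proj = map2 (I.image J).proj ∘ₗ map2 I.proj from
    LinearMap.congr_fun h t
  ext x y
  rfl

theorem LIdeal.map3_quotMap (I J : LIdeal 𝕜 L) (t : L ⊗[𝕜] L ⊗[𝕜] L) :
    map3 (I.quotMap J) (map3 J.proj t) = map3 (I.image J).proj (map3 I.proj t) := by
  suffices h : map3 (I.quotMap J) ∘ₗ map3 J.proj = map3 (I.image J).proj ∘ₗ map3 I.proj from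
    LinearMap.congr_fun h t
  ext x y z
  rfl

theorem LIdeal.coneMap_coneD4 (I J : LIdeal 𝕜 L) (c : L ⊗[𝕜] L ⊗[𝕜] L)
    (e : J.Quot ⊗[𝕜] J.Quot ⊗[𝕜] J.Quot ⊗[𝕜] J.Quot) :
    I.coneMap J (coneD4 J.proj (c, e)) =
      coneD4 (I.image J).proj (map3 I.proj c, map4 (I.quotMap J) e) := by
  simp only [coneD4_apply, LIdeal.coneMap, LinearMap.prodMap_apply, map_add, map_neg,
    d4_map4 _ (I.quotMap_br J), LIdeal.map3_quotMap,
    d3_map3 I.proj fun x y => (I.br_proj x y).symm]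

theorem LIdeal.coneMap_mem_ker (I J : LIdeal 𝕜 L) :
    LinearMap.ker (coneD3 J.proj) ≤ (LinearMap.ker (coneD3 (I.image J).proj)).comap
      (I.coneMap J) := by
  rintro ⟨a, b⟩ h
  rw [LinearMap.mem_ker, coneD3_apply, Prod.mk_eq_zero, neg_eq_zero] at h
  rw [Submodule.mem_comap, LinearMap.mem_ker, LIdeal.coneMap, LinearMap.prodMap_apply,
    coneD3_apply, d2_map2 I.proj fun x y => (I.br_proj x y).symm, h.1,
    d3_map3 _ (I.quotMap_br J), ← LIdeal.map2_quotMap, ← map_add, h.2]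
  simp

/-- A 3-chain of the cone of `L → L / J` whose image in the cone of `L / I → (L / I) / (J / I)`
is a boundary lies, modulo boundaries, in the kernel of `L ⊗ L → L/I ⊗ L/I`. -/
theorem LIdeal.exists_sub_coneD4_eq {I J : LIdeal 𝕜 L} (hIJ : I.toSubmodule ≤ J.toSubmodule)
    {m : (L ⊗[𝕜] L) × (J.Quot ⊗[𝕜] J.Quot ⊗[𝕜] J.Quot)}
    (hm : I.coneMap J m ∈ LinearMap.range (coneD4 (I.image J).proj)) :
    ∃ c, ∃ a ∈ LinearMap.ker (map2 I.proj), m = (a, 0) + coneD4 J.proj (c, 0) := by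
  -- With no second component, the bounding chain lifts along `L → L/I` alone. The corrected chain
  -- is then killed by `coneMap`, which is injective on the second factor.
  obtain ⟨c', hc'⟩ := exists_coneD4_eq (fun x y => ((I.image J).br_proj x y).symm)
    (Submodule.mkQ_surjective _) hm
  obtain ⟨c, rfl⟩ := map3_surjective I.toSubmodule.mkQ_surjective c'
  have h : I.coneMap J (m - coneD4 J.proj (c, 0)) = 0 := by
    rw [map_sub, LIdeal.coneMap_coneD4, map_zero, hc', sub_self]
  obtain ⟨h1, h2⟩ := Prod.ext_iff.1 h
  refine ⟨c, (m - coneD4 J.proj (c, 0)).1, h1, ?_⟩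
  have h3 : (m - coneD4 J.proj (c, 0)).2 = 0 :=
    map3_injective (I.quotMap_injective hIJ) (h2.trans (map_zero _).symm)
  conv_lhs => rw [← sub_add_cancel m (coneD4 J.proj (c, 0))]
  exact congrArg (· + _) (Prod.ext rfl h3)

end Relative

end

end LeibnizAlgebra

/-! ### The dimension bound -/

/-- For an ideal `n` of a finite-dimensional nilpotent Leibniz algebra `g`,
`dim HL₂(g, n) ≤ dim HL₂(g / (g² ∩ n), n / (g² ∩ n)) + 2 dim(g² ∩ n) d(g / Z(g, n))`,
where `Z(g, n) = Z(g) ∩ n`. -/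
theorem theorem3p5 {𝕜 : Type*} [Field 𝕜] {g : Type*} [AddCommGroup g] [Module 𝕜 g]
    [LeibnizAlgebra 𝕜 g] [FiniteDimensional 𝕜 g]
    (hg : LeibnizAlgebra.IsNilpotent 𝕜 g) (n : LeibnizAlgebra.LIdeal 𝕜 g) :
    Module.finrank 𝕜 (LeibnizAlgebra.HL2 n) ≤
      Module.finrank 𝕜 (LeibnizAlgebra.HL2
        (((LeibnizAlgebra.derived 𝕜 g).inter n).image n)) +
      2 * Module.finrank 𝕜 ((LeibnizAlgebra.derived 𝕜 g).inter n).toSubmodule *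
        LeibnizAlgebra.minGen 𝕜 ((LeibnizAlgebra.center 𝕜 g).inter n).Quot := by
  open LeibnizAlgebra in
  obtain ⟨S, hcard, hS⟩ :=
    exists_generates_card_eq_minGen (𝕜 := 𝕜) (L := ((center 𝕜 g).inter n).Quot)
  let I := (derived 𝕜 g).inter n
  let v : S → g := fun s => (Submodule.mkQ_surjective _ s.1).choose
  have hv : ∀ s : S, ((center 𝕜 g).inter n).proj (v s) = s.1 := fun s =>
    (Submodule.mkQ_surjective _ s.1).choose_spec
  obtain ⟨W, hWcard, hW⟩ :=
    exists_submodule_tmul_mem (Q := n.Quot ⊗[𝕜] n.Quot ⊗[𝕜] n.Quot) I.toSubmodule v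
  rw [Fintype.card_coe, hcard] at hWcard
  refine le_trans ?_ (Nat.add_le_add_left hWcard _)
  refine finrank_quotient_le_add (I.coneMap n) _ _ W _ _ (I.coneMap_mem_ker n) ?_ ?_
  · rintro _ ⟨⟨c, e⟩, rfl⟩
    exact ⟨_, (I.coneMap_coneD4 n c e).symm⟩
  · intro m hm
    obtain ⟨c, a, ha, rfl⟩ := LIdeal.exists_sub_coneD4_eq inf_le_right hm
    refine Submodule.add_mem _ ?_ (Submodule.mem_sup_right ⟨_, rfl⟩)
    -- The chains `a` for which `(a, 0)` lies in `W` modulo boundaries.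
    let E := (W ⊔ LinearMap.range (coneD4 n.proj)).comap (LinearMap.inl 𝕜 _ _)
    refine ker_map2_proj_le (E := E) ?_ ha
    refine tmul_mem_of_generates (n := n) (E := E) ?_ hS ?_
    · exact fun t ht => Submodule.mem_sup_right (d3_mem_range_coneD4 _ ht)
    · exact fun s hs => ⟨v ⟨s, hs⟩, hv ⟨s, hs⟩, fun i hi =>
        ⟨Submodule.mem_sup_left (hW ⟨s, hs⟩ i hi).1, Submodule.mem_sup_left (hW ⟨s, hs⟩ i hi).2⟩⟩
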